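/- Let $\mathbb T^9=\mathbb R^9/\mathbb Z^9$, with tangent bundle identified with $\mathbb T^9\times\mathbb R^9$ by translations. For an invertible linear map $A$ between finite-dimensional normed spaces let $K(A)=\|A\|\cdot\|A^{-1}\|$ denote its quasi-conformal distortion; a linear automorphism $A$ of a finite-dimensional real vector space is called conformal in some norm if $K(A)=1$ with respect to some norm on that space. If $f:\mathbb T^9\to\mathbb T^9$ is a diffeomorphism and $E\subset T\mathbb T^9$ is a subbundle with $D_pf(E(p))=E(f(p))$ for all $p$, then $Df|_E$ is called uniformly quasi-conformal if the distortions $K(D_pf^n|_{E(p)})$ (with respect to the Euclidean norm) are bounded uniformly in $p\in\mathbb T^9$ and $n\ge 0$. There exist a family $f_\epsilon$, $\epsilon\in\mathbb R$, of real analytic diffeomorphisms of $\mathbb T^9$, jointly real analytic in $(\epsilon,p)$, and a continuous three-dimensional subbundle $E$ of $T\mathbb T^9$ such that: 1. $f_0$ is an Anosov linear automorphism of $\mathbb T^9$, i.e. it is induced by a matrix in $GL(9,\mathbb Z)$ with no complex eigenvalue of modulus one; 2. for every $\epsilon$, $Df_\epsilon$ preserves $E$, i.e. $D_pf_\epsilon(E(p))=E(f_\epsilon(p))$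 for every $p\in\mathbb T^9$; 3. for every $\epsilon$, every $n\ge 1$ and every $p$ with $f_\epsilon^n(p)=p$, the linear automorphism $D_pf_\epsilon^n|_{E(p)}$ of $E(p)$ is conformal in some norm; 4. for every $\epsilon\ne 0$, $Df_\epsilon|_E$ is not uniformly quasi-conformal. -/

import Mathlib

open Filter Topology

noncomputable section

/-- The tangent space of the torus `(ℝ/ℤ)^d` (at any point, the tangent bundle being trivialized by
translations): `ℝ^d` with its Euclidean norm. -/
abbrev Tangent (d : ℕ) : Type := EuclideanSpace ℝ (Fin d)

/-- The universal covering `ℝ^d → (ℝ/ℤ)^d`. -/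
def torusProj {d : ℕ} (v : Tangent d) : UnitAddTorus (Fin d) :=
  fun i => ((v i : ℝ) : UnitAddCircle)

/-- A map of the torus is real analytic: it lifts to a real analytic map of `ℝ^d`. -/
def TorusAnalytic {d : ℕ} (f : UnitAddTorus (Fin d) → UnitAddTorus (Fin d)) : Prop :=
  ∃ F : Tangent d → Tangent d, AnalyticOnNhd ℝ F Set.univ ∧
    ∀ v, f (torusProj v) = torusProj (F v)

/-- A real analytic diffeomorphism of the torus: a real analytic map with a real analytic
inverse. -/
def TorusAnalyticDiffeo {d : ℕ} (f : UnitAddTorus (Fin d) → UnitAddTorus (Fin d)) : Prop :=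
  TorusAnalytic f ∧ ∃ g : UnitAddTorus (Fin d) → UnitAddTorus (Fin d),
    TorusAnalytic g ∧ Function.LeftInverse g f ∧ Function.RightInverse g f

/-- A family `f ε`, `ε ∈ ℝ`, of maps of the torus is analytic: `f ε p` is jointly real analytic in
`(ε, p)`, i.e. lifts to a jointly real analytic map `ℝ × ℝ^d → ℝ^d`. -/
def AnalyticTorusFamily {d : ℕ} (f : ℝ → UnitAddTorus (Fin d) → UnitAddTorus (Fin d)) : Prop :=
  ∃ F : ℝ × Tangent d → Tangent d, AnalyticOnNhd ℝ F Set.univ ∧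
    ∀ ε v, f ε (torusProj v) = torusProj (F (ε, v))

/-- `A` is the derivative of `f` at `p`, computed in the translation charts `v ↦ p + torusProj v`
at `p` and `w ↦ f p + torusProj w` at `f p`. -/
def HasTorusDerivAt {d : ℕ} (f : UnitAddTorus (Fin d) → UnitAddTorus (Fin d))
    (A : Tangent d →L[ℝ] Tangent d) (p : UnitAddTorus (Fin d)) : Prop :=
  ∃ F : Tangent d → Tangent d, F 0 = 0 ∧ HasFDerivAt F A 0 ∧
    ∀ᶠ v in 𝓝 (0 : Tangent d), f (p + torusProj v) = f p + torusProj (F v)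

open Classical in
/-- The derivative `D_p f : ℝ^d → ℝ^d` of a map of the torus (`0` if `f` is not differentiable
at `p`). -/
def torusDeriv {d : ℕ} (f : UnitAddTorus (Fin d) → UnitAddTorus (Fin d))
    (p : UnitAddTorus (Fin d)) : Tangent d →L[ℝ] Tangent d :=
  if h : ∃ A, HasTorusDerivAt f A p then h.choose else 0

/-- The derivative is unique. -/
theorem HasTorusDerivAt.unique {d : ℕ} {f : UnitAddTorus (Fin d) → UnitAddTorus (Fin d)}
    {A B : Tangent d →L[ℝ] Tangent d} {p : UnitAddTorus (Fin d)}
    (hA : HasTorusDerivAt f A p) (hB : HasTorusDerivAt f B p) : A = B := by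
  obtain ⟨F, F0, hF, hFe⟩ := hA
  obtain ⟨G, G0, hG, hGe⟩ := hB
  have hsmall : ∀ᶠ v in 𝓝 (0 : Tangent d), ‖F v - G v‖ < 1 := by
    have hc : ContinuousAt (fun v => ‖F v - G v‖) 0 :=
      (hF.continuousAt.sub hG.continuousAt).norm
    have : ‖F 0 - G 0‖ < 1 := by simp [F0, G0]
    exact hc.eventually_lt continuousAt_const this
  have heq : F =ᶠ[𝓝 0] G := by
    filter_upwards [hFe, hGe, hsmall] with v h1 h2 h3
    have h4 : torusProj (F v) = torusProj (G v) := add_left_cancel (h1.symm.trans h2)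
    ext i
    have h5 : ((F v i : ℝ) : UnitAddCircle) = ((G v i : ℝ) : UnitAddCircle) := congrFun h4 i
    have h6 : ((F v i - G v i : ℝ) : UnitAddCircle) = 0 := by
      rw [AddCircle.coe_sub, h5, sub_self]
    obtain ⟨m, hm⟩ := (AddCircle.coe_eq_zero_iff (1 : ℝ)).1 h6
    have hm1 : (m : ℝ) = F v i - G v i := by simpa using hm
    have hi : |F v i - G v i| < 1 := by
      have := PiLp.norm_apply_le (F v - G v) i
      rw [Real.norm_eq_abs] at this
      exact lt_of_le_of_lt (by simpa using this) h3
    rw [← hm1] at hi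
    have hm0 : m = 0 := by
      by_contra hne
      have h1 : (1 : ℝ) ≤ |(m : ℝ)| := by
        have h2 : (1 : ℤ) ≤ |m| := Int.one_le_abs hne
        have h7 : ((1 : ℤ) : ℝ) ≤ ((|m| : ℤ) : ℝ) := Int.cast_le.2 h2
        rwa [Int.cast_one, Int.cast_abs] at h7
      exact absurd hi (not_lt.2 h1)
    rw [hm0] at hm1
    have : F v i - G v i = 0 := by simpa using hm1.symm
    linarith
  exact hF.unique (hG.congr_of_eventuallyEq heq)

/-- The derivative of a map of the torus is the derivative of any of its lifts to `ℝ^d`. -/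
theorem torusDeriv_torusProj {d : ℕ} {f : UnitAddTorus (Fin d) → UnitAddTorus (Fin d)}
    {F : Tangent d → Tangent d} (hlift : ∀ v, f (torusProj v) = torusProj (F v))
    {A : Tangent d →L[ℝ] Tangent d} {x : Tangent d} (hA : HasFDerivAt F A x) :
    torusDeriv f (torusProj x) = A := by
  have hadd : ∀ v w : Tangent d, torusProj (v + w) = torusProj v + torusProj w := by
    intro v w
    funext i
    simp [torusProj]
  have h : HasTorusDerivAt f A (torusProj x) := by
    refine ⟨fun v => F (x + v) - F x, by simp, ?_, Eventually.of_forall fun v => ?_⟩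
    · have h0 : HasFDerivAt F A (x + 0) := by simpa using hA
      exact ((hasFDerivAt_comp_add_left x).2 h0).sub_const (F x)
    · rw [← hadd, hlift, hlift, ← hadd]
      simp
  have hex : ∃ A, HasTorusDerivAt f A (torusProj x) := ⟨A, h⟩
  rw [torusDeriv, dif_pos hex]
  exact hex.choose_spec.unique h

/-- The endomorphism of the torus induced by an integer matrix. -/
def torusLinearMap {d : ℕ} (M : Matrix (Fin d) (Fin d) ℤ) (p : UnitAddTorus (Fin d)) :
    UnitAddTorus (Fin d) :=
  fun i => ∑ j, M i j • p j

/-- `f` is a linear Anosov automorphism of the torus: it is induced by a matrix in `GL(d, ℤ)` none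
of whose complex eigenvalues has modulus one. -/
def IsAnosovAutomorphism {d : ℕ} (f : UnitAddTorus (Fin d) → UnitAddTorus (Fin d)) : Prop :=
  ∃ M : Matrix (Fin d) (Fin d) ℤ, IsUnit M.det ∧
    (∀ z : ℂ, Module.End.HasEigenvalue (Matrix.toLin' (M.map (Int.cast : ℤ → ℂ))) z → ‖z‖ ≠ 1) ∧
    f = torusLinearMap M

/-- `E` is a continuous `k`-dimensional subbundle of the tangent bundle of the torus: it has
continuous local frames. -/
def IsContinuousSubbundle {d : ℕ} (k : ℕ)
    (E : UnitAddTorus (Fin d) → Submodule ℝ (Tangent d)) : Prop :=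
  ∀ p, ∃ U : Set (UnitAddTorus (Fin d)), IsOpen U ∧ p ∈ U ∧
    ∃ s : Fin k → UnitAddTorus (Fin d) → Tangent d,
      (∀ i, ContinuousOn (s i) U) ∧
      ∀ q ∈ U, LinearIndependent ℝ (fun i => s i q) ∧
        Submodule.span ℝ (Set.range fun i => s i q) = E q

/-- `Df` preserves the bundle `E`: `D_p f (E p) = E (f p)` for every `p`. -/
def PreservesBundle {d : ℕ} (f : UnitAddTorus (Fin d) → UnitAddTorus (Fin d))
    (E : UnitAddTorus (Fin d) → Submodule ℝ (Tangent d)) : Prop :=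
  ∀ p, (E p).map (torusDeriv f p : Tangent d →ₗ[ℝ] Tangent d) = E (f p)

/-- A seminorm is a norm. -/
def IsNorm {V : Type*} [AddCommGroup V] [Module ℝ V] (N : Seminorm ℝ V) : Prop :=
  ∀ v, N v = 0 → v = 0

/-- The operator norm of a linear map `A : V → W` with respect to norms `N` on `V` and `N'` on
`W`. -/
def opNorm {V W : Type*} [AddCommGroup V] [Module ℝ V] [AddCommGroup W] [Module ℝ W]
    (N : Seminorm ℝ V) (N' : Seminorm ℝ W) (A : V →ₗ[ℝ] W) : ℝ :=
  sInf {c : ℝ | 0 ≤ c ∧ ∀ v, N' (A v) ≤ c * N v}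

/-- The quasi-conformal distortion `K(A) = ‖A‖ ‖A⁻¹‖` of an invertible linear map. -/
def qcDistortion {V W : Type*} [AddCommGroup V] [Module ℝ V] [AddCommGroup W] [Module ℝ W]
    (N : Seminorm ℝ V) (N' : Seminorm ℝ W) (A : V ≃ₗ[ℝ] W) : ℝ :=
  opNorm N N' (A : V →ₗ[ℝ] W) * opNorm N' N (A.symm : W →ₗ[ℝ] V)

/-- `A` is conformal in some norm: `K(A) = 1` with respect to some norm on `V`. -/
def ConformalInSomeNorm {V : Type*} [AddCommGroup V] [Module ℝ V] (A : V ≃ₗ[ℝ] V) : Prop :=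
  ∃ N : Seminorm ℝ V, IsNorm N ∧ qcDistortion N N A = 1

/-- The isomorphism `A` of subspaces of `ℝ^d` is the restriction of `L`. -/
def IsRestriction {d : ℕ} {S T : Submodule ℝ (Tangent d)}
    (L : Tangent d →L[ℝ] Tangent d) (A : S ≃ₗ[ℝ] T) : Prop :=
  ∀ v : S, (A v : Tangent d) = L v

/-- For a bundle `E` preserved by `Df`, the cocycle `Df|_E` is uniformly quasi-conformal: the
distortion (for the Euclidean norm) of `Df^n|_E : E p → E (f^n p)` is bounded uniformly in `p`
and `n`. -/
def UniformlyQuasiConformal {d : ℕ} (f : UnitAddTorus (Fin d) → UnitAddTorus (Fin d))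
    (E : UnitAddTorus (Fin d) → Submodule ℝ (Tangent d)) : Prop :=
  ∃ C : ℝ, ∀ (p : UnitAddTorus (Fin d)) (n : ℕ) (A : E p ≃ₗ[ℝ] E (f^[n] p)),
    IsRestriction (torusDeriv (f^[n]) p) A →
      qcDistortion (normSeminorm ℝ (E p)) (normSeminorm ℝ (E (f^[n] p))) A ≤ C

end

/-!
The example is a shear over a linear automorphism. Let `λ = 2 + √5`. The automorphism
(`anosovMatrix`) has an invariant plane in the first four coordinates on which it is `λ` times a
rotation by an angle incommensurable with `π`, and an eigenvector with eigenvalue `λ` in the next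
two; the bundle `E` is spanned by the plane and this vector, and is constant. The last three
coordinates carry a hyperbolic block that only fills up the dimension. The perturbation adds `ε sin
(2π v₄) u`, where `u` lies in the plane and `v₄` is a coordinate of the second block (coordinates
being numbered from zero). Since `v₄` is constant on the plane, `E` stays invariant, and in the
identification `E ≅ ℂ × ℝ` (`fiberMap`) the derivative of the `n`-th iterate is `(w, c) ↦ λⁿ (rⁿ w
+ c τₙ, c)`, where `r` is the rotation (`torusDeriv_iterate_fiberMap`). So `Df` acts on `E` by
dilated orientation-preserving isometries of the plane `ℂ × {1}`.

For `n > 0` such an isometry has, at every point, the rotation part `rⁿ ≠ 1`, hence a fixed point,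
hence is conformal for a norm centred at the fixed point (`conformalInSomeNorm_affineEquiv`). That
`r` has infinite order is seen on the traces `rⁿ + r⁻ⁿ ∈ ℤ[√5]`: the Galois conjugate of `r + r⁻¹ =
4 - 2√5` is `4 + 2√5 > 2`, so the conjugate traces are never `2` for `n > 0`
(`rotationUnit_pow_ne_one`).

Uniform quasi-conformality would bound the translation parts `τₙ`
(`exists_norm_translationPart_le`). Along the sixth coordinate axis `τₙ` is, up to a nonzero
constant and a factor of modulus one, a sum of cosines with distinct frequencies and unimodular
coefficients (`translationPart_axis`), whose `L²` norm grows like `√n`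
(`not_bounded_sum_unimodular_mul_cos`).
-/

noncomputable section

/-! ### A rotation of infinite order -/

/-- The unit `2 + √5` of `ℤ[√5]`, the dilation factor of the automorphism on the bundle. -/
def dilation : ℝ := 2 + √5

/-- The trace `4 - 2√5` of the rotation; its Galois conjugate `4 + 2√5` exceeds `2`. -/
def rotationTrace : ℝ := 4 - 2 * √5

/-- The sine of the rotation angle. -/
def rotationSin : ℝ := √(1 - (rotationTrace / 2) ^ 2)

/-- The complex number of modulus one and trace `4 - 2√5`. -/
def rotationUnit : ℂ := ⟨rotationTrace / 2, rotationSin⟩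

lemma sqrt_five_sq : √5 ^ 2 = (5 : ℝ) := Real.sq_sqrt (by norm_num)

lemma sqrt_five_mem_Ioo : √5 ∈ Set.Ioo (2.2 : ℝ) 2.3 :=
  ⟨(Real.lt_sqrt (by norm_num)).2 (by norm_num), (Real.sqrt_lt' (by norm_num)).2 (by norm_num)⟩

lemma dilation_pos : 0 < dilation := by unfold dilation; positivity

lemma dilation_sq : dilation ^ 2 = 1 + 4 * dilation := by
  unfold dilation; linear_combination sqrt_five_sq

lemma dilation_mul_rotationTrace : dilation * rotationTrace = -2 := by
  unfold dilation rotationTrace; linear_combination (-2) * sqrt_five_sq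

lemma rotationSin_sq_add : rotationSin ^ 2 + (rotationTrace / 2) ^ 2 = 1 := by
  have h := sqrt_five_mem_Ioo
  rw [rotationSin, Real.sq_sqrt]
  · ring
  · unfold rotationTrace
    nlinarith [h.1, h.2]

lemma rotationSin_pos : 0 < rotationSin := by
  have h := sqrt_five_mem_Ioo
  refine Real.sqrt_pos.2 ?_
  unfold rotationTrace
  nlinarith [h.1, h.2]

lemma normSq_rotationUnit : Complex.normSq rotationUnit = 1 := by
  rw [Complex.normSq_apply]
  simp only [rotationUnit]
  linear_combination rotationSin_sq_add

lemma norm_rotationUnit : ‖rotationUnit‖ = 1 := by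
  rw [Complex.norm_def, normSq_rotationUnit, Real.sqrt_one]

lemma rotationUnit_ne_zero : rotationUnit ≠ 0 := by
  intro h
  simpa [h] using norm_rotationUnit

lemma rotationUnit_sq : rotationUnit ^ 2 = rotationTrace * rotationUnit - 1 := by
  apply Complex.ext
  · simp [pow_two, rotationUnit]
    linear_combination (-1) * rotationSin_sq_add
  · simp [pow_two, rotationUnit]
    ring

/-- The sequence `2, s, s² - 2, …` of traces of the powers of a matrix of determinant one and
trace `s`. -/
def powerTrace (s : ℝ) : ℕ → ℝ
  | 0 => 2
  | 1 => s
  | n + 2 => s * powerTrace s (n + 1) - powerTrace s n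

lemma powerTrace_rotationTrace (n : ℕ) :
    powerTrace rotationTrace n = 2 * (rotationUnit ^ n).re := by
  induction n using Nat.twoStepInduction with
  | zero => simp [powerTrace]
  | one => simp [powerTrace, rotationUnit]; ring
  | more n h0 h1 =>
    have : rotationUnit ^ (n + 2) = rotationTrace * rotationUnit ^ (n + 1) - rotationUnit ^ n := by
      rw [pow_add, rotationUnit_sq]; ring
    rw [powerTrace, h0, h1, this, Complex.sub_re, Complex.re_ofReal_mul]
    ring

/-- The traces for `4 - 2√5` and for `4 + 2√5` are Galois conjugate elements of `ℤ[√5]`. -/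
lemma powerTrace_conjugate (n : ℕ) : ∃ a b : ℤ,
    powerTrace (4 - 2 * √5) n = a - b * √5 ∧ powerTrace (4 + 2 * √5) n = a + b * √5 := by
  induction n using Nat.twoStepInduction with
  | zero => exact ⟨2, 0, by simp [powerTrace], by simp [powerTrace]⟩
  | one => exact ⟨4, 2, by simp [powerTrace], by simp [powerTrace]⟩
  | more n h0 h1 =>
    obtain ⟨a, b, h0, h0'⟩ := h0
    obtain ⟨c, d, h1, h1'⟩ := h1
    refine ⟨4 * c + 10 * d - a, 4 * d + 2 * c - b, ?_, ?_⟩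
    · rw [powerTrace, h0, h1]
      push_cast
      linear_combination 2 * (d : ℝ) * sqrt_five_sq
    · rw [powerTrace, h0', h1']
      push_cast
      linear_combination 2 * (d : ℝ) * sqrt_five_sq

lemma two_le_powerTrace_and_lt_succ {s : ℝ} (hs : 2 < s) (n : ℕ) :
    2 ≤ powerTrace s n ∧ powerTrace s n < powerTrace s (n + 1) := by
  induction n with
  | zero => simpa [powerTrace] using hs
  | succ n ih =>
    refine ⟨ih.1.trans ih.2.le, ?_⟩
    rw [powerTrace]
    nlinarith [ih.1, ih.2]

/-- The rotation has infinite order: a relation `rotationUnit ^ n = 1` would say that the `n`-th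
power trace is `2`, and would persist for the Galois conjugate `4 + 2√5`, which is the trace of a
hyperbolic matrix. -/
lemma rotationUnit_pow_ne_one {n : ℕ} (hn : 0 < n) : rotationUnit ^ n ≠ 1 := by
  intro h
  have h2 : powerTrace (4 - 2 * √5) n = 2 := by
    have := powerTrace_rotationTrace n
    rw [h] at this
    simpa [rotationTrace] using this
  obtain ⟨a, b, ha, hb⟩ := powerTrace_conjugate n
  have hirr : Irrational √5 := by
    simpa using Nat.Prime.irrational_sqrt (p := 5) (by norm_num)
  have hb0 : b = 0 := by
    by_contra hne
    refine ((hirr.intCast_mul hne).ne_int (a - 2)) ?_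
    push_cast
    linarith
  have hpos : (2 : ℝ) < powerTrace (4 + 2 * √5) n := by
    obtain ⟨m, rfl⟩ := Nat.exists_eq_succ_of_ne_zero hn.ne'
    have hs : (2 : ℝ) < 4 + 2 * √5 := by linarith [Real.sqrt_nonneg 5]
    have := two_le_powerTrace_and_lt_succ hs m
    exact this.1.trans_lt this.2
  rw [hb0] at ha hb
  simp only [Int.cast_zero, zero_mul, sub_zero, add_zero] at ha hb
  linarith

/-! ### Growth of lacunary cosine sums -/

lemma integral_cos_two_pi_int {m : ℤ} (hm : m ≠ 0) :
    ∫ θ in (0 : ℝ)..1, Real.cos (2 * Real.pi * (m * θ)) = 0 := by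
  have hne : 2 * Real.pi * (m : ℝ) ≠ 0 := by
    have : (m : ℝ) ≠ 0 := by exact_mod_cast hm
    positivity
  have h : ∀ θ : ℝ, Real.cos (2 * Real.pi * (m * θ)) = Real.cos ((2 * Real.pi * m) * θ) :=
    fun θ => by ring_nf
  simp_rw [h]
  rw [intervalIntegral.integral_comp_mul_left (fun x => Real.cos x) hne, integral_cos]
  have : Real.sin (2 * Real.pi * m * 1) = 0 := by
    rw [show 2 * Real.pi * (m : ℝ) * 1 = ((2 * m : ℤ) : ℝ) * Real.pi by push_cast; ring]
    exact Real.sin_int_mul_pi _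
  rw [this]
  simp

lemma integral_cos_mul_cos_of_ne {m n : ℕ} (h : m ≠ n) :
    ∫ θ in (0 : ℝ)..1, Real.cos (2 * Real.pi * (m * θ)) * Real.cos (2 * Real.pi * (n * θ)) = 0 := by
  have h1 : ((m : ℤ) - n) ≠ 0 := by omega
  have h2 : ((m : ℤ) + n) ≠ 0 := by omega
  have h3 : ∀ θ : ℝ, Real.cos (2 * Real.pi * (m * θ)) * Real.cos (2 * Real.pi * (n * θ)) =
      (1 / 2) * Real.cos (2 * Real.pi * (((m - n : ℤ) : ℝ) * θ)) +
      (1 / 2) * Real.cos (2 * Real.pi * (((m + n : ℤ) : ℝ) * θ)) := by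
    intro θ
    have e1 : 2 * Real.pi * (((m - n : ℤ) : ℝ) * θ) =
      2 * Real.pi * (m * θ) - 2 * Real.pi * (n * θ) := by push_cast; ring
    have e2 : 2 * Real.pi * (((m + n : ℤ) : ℝ) * θ) =
      2 * Real.pi * (m * θ) + 2 * Real.pi * (n * θ) := by push_cast; ring
    rw [e1, e2, Real.cos_sub, Real.cos_add]
    ring
  simp_rw [h3]
  rw [intervalIntegral.integral_add, intervalIntegral.integral_const_mul,
    intervalIntegral.integral_const_mul, integral_cos_two_pi_int h1, integral_cos_two_pi_int h2]
  · simp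
  all_goals exact Continuous.intervalIntegrable (by fun_prop) _ _

lemma half_le_integral_cos_mul_cos (m : ℕ) : (1 / 2 : ℝ) ≤
    ∫ θ in (0 : ℝ)..1, Real.cos (2 * Real.pi * (m * θ)) * Real.cos (2 * Real.pi * (m * θ)) := by
  rcases eq_or_ne m 0 with rfl | hm
  · norm_num
  have h3 : ∀ θ : ℝ, Real.cos (2 * Real.pi * (m * θ)) * Real.cos (2 * Real.pi * (m * θ)) =
      (1 / 2) + (1 / 2) * Real.cos (2 * Real.pi * (((2 * m : ℤ) : ℝ) * θ)) := by
    intro θ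
    rw [← pow_two, Real.cos_sq]
    push_cast
    ring_nf
  simp_rw [h3]
  rw [intervalIntegral.integral_add, intervalIntegral.integral_const_mul,
    integral_cos_two_pi_int (m := 2 * m) (by omega)]
  · simp
  all_goals exact Continuous.intervalIntegrable (by fun_prop) _ _

/-- Cosines of distinct frequencies are orthogonal on a period, hence a Bessel-type lower bound. -/
lemma half_sum_sq_le_integral {β : ℕ → ℕ} (hβ : Function.Injective β) (a : ℕ → ℝ) (n : ℕ) :
    (1 / 2) * ∑ j ∈ Finset.range n, a j ^ 2 ≤
      ∫ θ in (0 : ℝ)..1, (∑ j ∈ Finset.range n, a j * Real.cos (2 * Real.pi * (β j * θ))) ^ 2 := by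
  have h1 : ∀ θ : ℝ, (∑ j ∈ Finset.range n, a j * Real.cos (2 * Real.pi * (β j * θ))) ^ 2 =
      ∑ i ∈ Finset.range n, ∑ j ∈ Finset.range n, (a i * a j) *
        (Real.cos (2 * Real.pi * (β i * θ)) * Real.cos (2 * Real.pi * (β j * θ))) := by
    intro θ
    rw [pow_two, Finset.sum_mul_sum]
    exact Finset.sum_congr rfl fun i _ => Finset.sum_congr rfl fun j _ => by ring
  simp_rw [h1]
  rw [intervalIntegral.integral_finsetSum
    fun i _ => Continuous.intervalIntegrable (by fun_prop) _ _, Finset.mul_sum]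
  refine Finset.sum_le_sum fun i hi => ?_
  rw [intervalIntegral.integral_finsetSum
    fun i _ => Continuous.intervalIntegrable (by fun_prop) _ _, Finset.sum_eq_single i]
  · rw [intervalIntegral.integral_const_mul]
    nlinarith [half_le_integral_cos_mul_cos (β i), sq_nonneg (a i)]
  · intro j _ hj
    rw [intervalIntegral.integral_const_mul,
      integral_cos_mul_cos_of_ne (hβ.ne hj.symm), mul_zero]
  · exact fun h => absurd hi h

/-- Cosine sums with distinct frequencies and unimodular coefficients are not uniformly bounded:
their `L²` norms grow like `√(n / 2)`. -/
lemma not_bounded_sum_unimodular_mul_cos {β : ℕ → ℕ} (hβ : Function.Injective β) {ζ : ℕ → ℂ}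
    (hζ : ∀ j, ‖ζ j‖ = 1) (C : ℝ) : ∃ (n : ℕ) (θ : ℝ),
      C < ‖∑ j ∈ Finset.range n, ζ j * (Real.cos (2 * Real.pi * (β j * θ)) : ℂ)‖ := by
  by_contra! hC
  have hC0 : 0 ≤ C := (norm_nonneg _).trans (hC 0 0)
  obtain ⟨n, hn⟩ := exists_nat_gt (2 * C ^ 2)
  have hre := half_sum_sq_le_integral hβ (fun j => (ζ j).re) n
  have him := half_sum_sq_le_integral hβ (fun j => (ζ j).im) n
  have hsum : ∑ j ∈ Finset.range n, (ζ j).re ^ 2 + ∑ j ∈ Finset.range n, (ζ j).im ^ 2 = n := by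
    rw [← Finset.sum_add_distrib]
    have : ∀ j ∈ Finset.range n, (ζ j).re ^ 2 + (ζ j).im ^ 2 = 1 := fun j _ => by
      have := Complex.sq_norm (ζ j)
      rw [hζ, Complex.normSq_apply] at this
      linarith
    rw [Finset.sum_congr rfl this]
    simp
  have hle : (∫ θ in (0 : ℝ)..1,
      (∑ j ∈ Finset.range n, (ζ j).re * Real.cos (2 * Real.pi * (β j * θ))) ^ 2) +
      (∫ θ in (0 : ℝ)..1,
      (∑ j ∈ Finset.range n, (ζ j).im * Real.cos (2 * Real.pi * (β j * θ))) ^ 2) ≤ C ^ 2 := by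
    rw [← intervalIntegral.integral_add (Continuous.intervalIntegrable (by fun_prop) _ _)
      (Continuous.intervalIntegrable (by fun_prop) _ _)]
    have hconst : (∫ _ in (0 : ℝ)..1, C ^ 2) = C ^ 2 := by simp
    rw [← hconst]
    refine intervalIntegral.integral_mono_on (by norm_num)
      (Continuous.intervalIntegrable (by fun_prop) _ _) (by simp) fun θ _ => ?_
    have h := hC n θ
    set z := ∑ j ∈ Finset.range n, ζ j * (Real.cos (2 * Real.pi * (β j * θ)) : ℂ) with hz
    have h1 : z.re = ∑ j ∈ Finset.range n, (ζ j).re * Real.cos (2 * Real.pi * (β j * θ)) := by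
      rw [hz, Complex.re_sum]
      exact Finset.sum_congr rfl fun j _ => Complex.re_mul_ofReal _ _
    have h2 : z.im = ∑ j ∈ Finset.range n, (ζ j).im * Real.cos (2 * Real.pi * (β j * θ)) := by
      rw [hz, Complex.im_sum]
      exact Finset.sum_congr rfl fun j _ => Complex.im_mul_ofReal _ _
    rw [← h1, ← h2]
    have h3 := Complex.sq_norm z
    rw [Complex.normSq_apply] at h3
    nlinarith [norm_nonneg z]
  linarith

/-! ### Maps of the torus and their lifts -/

lemma torusProj_add {d : ℕ} (v w : Tangent d) :
    torusProj (v + w) = torusProj v + torusProj w := by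
  funext i; simp [torusProj]

lemma torusProj_sub {d : ℕ} (v w : Tangent d) :
    torusProj (v - w) = torusProj v - torusProj w := by
  funext i; simp [torusProj]

lemma torusProj_surjective {d : ℕ} : Function.Surjective (torusProj (d := d)) := by
  intro p
  choose x hx using fun i => QuotientAddGroup.mk_surjective (p i)
  exact ⟨WithLp.toLp 2 x, funext hx⟩

/-- The linear map of `ℝ^d` induced by an integer matrix. -/
def integerLinearMap {d : ℕ} (M : Matrix (Fin d) (Fin d) ℤ) : Tangent d →L[ℝ] Tangent d :=
  Matrix.toEuclideanCLM (n := Fin d) (𝕜 := ℝ) (M.map (Int.cast : ℤ → ℝ))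

lemma integerLinearMap_apply {d : ℕ} (M : Matrix (Fin d) (Fin d) ℤ) (v : Tangent d) (i : Fin d) :
    integerLinearMap M v i = ∑ j, (M i j : ℝ) * v j := rfl

lemma torusLinearMap_torusProj {d : ℕ} (M : Matrix (Fin d) (Fin d) ℤ) (v : Tangent d) :
    torusLinearMap M (torusProj v) = torusProj (integerLinearMap M v) := by
  funext i
  simp only [torusLinearMap, torusProj, integerLinearMap_apply]
  have h : ∀ x : ℝ, (x : UnitAddCircle) = (QuotientAddGroup.mk' _ : ℝ →+ UnitAddCircle) x :=
    fun _ => rfl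
  simp only [h, map_sum]
  refine Finset.sum_congr rfl fun j _ => ?_
  rw [← map_zsmul, zsmul_eq_mul]

lemma iterate_torusProj {d : ℕ} {f : UnitAddTorus (Fin d) → UnitAddTorus (Fin d)}
    {F : Tangent d → Tangent d} (h : ∀ v, f (torusProj v) = torusProj (F v)) (n : ℕ)
    (v : Tangent d) : f^[n] (torusProj v) = torusProj (F^[n] v) :=
  (Function.Semiconj.iterate_right (fun v => (h v).symm) n v).symm

/-- The sine function on the circle `ℝ/ℤ`. -/
def circleSin (x : UnitAddCircle) : ℝ := ((AddCircle.toCircle x : Circle) : ℂ).im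

lemma circleSin_coe (x : ℝ) : circleSin (x : UnitAddCircle) = Real.sin (2 * Real.pi * x) := by
  rw [circleSin, AddCircle.toCircle_apply_mk, Circle.coe_exp, Complex.exp_ofReal_mul_I_im, div_one]

/-! ### The automorphism and its perturbation -/

/-- The matrix of the unperturbed automorphism. With `B = !![0, 1; 1, 4]`, whose eigenvalues are
`2 ± √5`, it is block diagonal with blocks `!![0, -B; B, -2]` of size four, `B` of size two, and
the companion matrix of `z³ + 5z² + 1`. -/
def anosovMatrix : Matrix (Fin 9) (Fin 9) ℤ :=
  !![0, 0, 0, -1, 0, 0, 0, 0, 0;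
     0, 0, -1, -4, 0, 0, 0, 0, 0;
     0, 1, -2, 0, 0, 0, 0, 0, 0;
     1, 4, 0, -2, 0, 0, 0, 0, 0;
     0, 0, 0, 0, 0, 1, 0, 0, 0;
     0, 0, 0, 0, 1, 4, 0, 0, 0;
     0, 0, 0, 0, 0, 0, 0, 1, 0;
     0, 0, 0, 0, 0, 0, 0, 0, 1;
     0, 0, 0, 0, 0, 0, -1, 0, -5]

/-- The inverse of `anosovMatrix`. -/
def anosovMatrixInv : Matrix (Fin 9) (Fin 9) ℤ :=
  !![-34, 8, -4, 1, 0, 0, 0, 0, 0;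
     8, -2, 1, 0, 0, 0, 0, 0, 0;
     4, -1, 0, 0, 0, 0, 0, 0, 0;
     -1, 0, 0, 0, 0, 0, 0, 0, 0;
     0, 0, 0, 0, -4, 1, 0, 0, 0;
     0, 0, 0, 0, 1, 0, 0, 0, 0;
     0, 0, 0, 0, 0, 0, 0, -5, -1;
     0, 0, 0, 0, 0, 0, 1, 0, 0;
     0, 0, 0, 0, 0, 0, 0, 1, 0]

lemma anosovMatrix_mul_inv : anosovMatrix * anosovMatrixInv = 1 := by decide +kernel

lemma anosovMatrixInv_mul : anosovMatrixInv * anosovMatrix = 1 := by decide +kernel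

lemma sum_anosovMatrix_mul {R : Type*} [CommRing R] (v : Fin 9 → R) (i : Fin 9) :
    ∑ j, (anosovMatrix i j : R) * v j =
      ![-v 3, -v 2 - 4 * v 3, v 1 - 2 * v 2, v 0 + 4 * v 1 - 2 * v 3, v 5, v 4 + 4 * v 5,
        v 7, v 8, -v 6 - 5 * v 8] i := by
  fin_cases i <;> simp [anosovMatrix, Fin.sum_univ_succ] <;> ring_nf!

/-- No eigenvalue `z` has modulus one: on the three blocks it satisfies `q² + 18q + 1 = 0` with
`q = z² + 2z`, respectively `z² = 4z + 1`, respectively `z³ + 5z² + 1 = 0`, and for `|z| = 1` one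
term of each equation dominates the others. -/
lemma anosovMatrix_hyperbolic {z : ℂ}
    (hz : Module.End.HasEigenvalue (Matrix.toLin' (anosovMatrix.map (Int.cast : ℤ → ℂ))) z) :
    ‖z‖ ≠ 1 := by
  intro h1
  obtain ⟨v, hv⟩ := hz.exists_hasEigenvector
  have hrow : ∀ i, ![-v 3, -v 2 - 4 * v 3, v 1 - 2 * v 2, v 0 + 4 * v 1 - 2 * v 3, v 5,
      v 4 + 4 * v 5, v 7, v 8, -v 6 - 5 * v 8] i = z * v i := fun i => by
    have h := congrFun hv.apply_eq_smul i
    rw [Matrix.toLin'_apply] at h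
    rw [← sum_anosovMatrix_mul]
    exact h
  have r0 : -v 3 = z * v 0 := hrow 0
  have r1 : -v 2 - 4 * v 3 = z * v 1 := hrow 1
  have r2 : v 1 - 2 * v 2 = z * v 2 := hrow 2
  have r3 : v 0 + 4 * v 1 - 2 * v 3 = z * v 3 := hrow 3
  have r4 : v 5 = z * v 4 := hrow 4
  have r5 : v 4 + 4 * v 5 = z * v 5 := hrow 5
  have r6 : v 7 = z * v 6 := hrow 6
  have r7 : v 8 = z * v 7 := hrow 7
  have r8 : -v 6 - 5 * v 8 = z * v 8 := hrow 8
  have z0 : z ≠ 0 := by rintro rfl; simp at h1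
  have p1 : (z ^ 2 + 2 * z) ^ 2 + 18 * (z ^ 2 + 2 * z) + 1 ≠ 0 := by
    intro h
    set q := z ^ 2 + 2 * z with hq
    have hq1 : 1 ≤ ‖q‖ := by
      have h2 := norm_sub_norm_le (2 : ℂ) (-z)
      have h3 : ‖q‖ = ‖2 - -z‖ := by
        rw [hq, show z ^ 2 + 2 * z = z * (2 - -z) by ring, norm_mul, h1, one_mul]
      rw [norm_neg, h1, Complex.norm_ofNat] at h2
      linarith
    have hq3 : ‖q‖ ≤ 3 := by
      refine (norm_add_le _ _).trans ?_
      rw [norm_pow, norm_mul, h1, Complex.norm_ofNat]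
      norm_num
    have h4 : ‖18 * q‖ ≤ ‖q‖ ^ 2 + 1 := by
      rw [show 18 * q = -(q ^ 2 + 1) by linear_combination h, norm_neg]
      refine (norm_add_le _ _).trans ?_
      rw [norm_pow, norm_one]
    rw [norm_mul, Complex.norm_ofNat] at h4
    nlinarith
  have p2 : z ^ 2 - 4 * z - 1 ≠ 0 := by
    intro h
    have h4 : ‖4 * z‖ ≤ 2 := by
      rw [show 4 * z = z ^ 2 - 1 by linear_combination -h]
      refine (norm_sub_le _ _).trans ?_
      rw [norm_pow, norm_one, h1]
      norm_num
    rw [norm_mul, Complex.norm_ofNat, h1] at h4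
    norm_num at h4
  have p3 : z ^ 3 + 5 * z ^ 2 + 1 ≠ 0 := by
    intro h
    have h4 : ‖5 * z ^ 2‖ ≤ 2 := by
      rw [show 5 * z ^ 2 = -(z ^ 3 + 1) by linear_combination h, norm_neg]
      refine (norm_add_le _ _).trans ?_
      rw [norm_pow, norm_one, h1]
      norm_num
    rw [norm_mul, Complex.norm_ofNat, norm_pow, h1] at h4
    norm_num at h4
  have v6 : v 6 = 0 := (mul_eq_zero.1 (show (z ^ 3 + 5 * z ^ 2 + 1) * v 6 = 0 by
    linear_combination (-z ^ 2 - 5 * z) * r6 + (-z - 5) * r7 - r8)).resolve_left p3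
  have v4 : v 4 = 0 := (mul_eq_zero.1 (show (z ^ 2 - 4 * z - 1) * v 4 = 0 by
    linear_combination (4 - z) * r4 - r5)).resolve_left p2
  -- `B² a = -q a` for `a = (v 0, v 1)`, the square root `B` being eliminated by `v 2` and `v 3`
  have e0 : v 0 + 4 * v 1 = -(z ^ 2 + 2 * z) * v 0 := by
    linear_combination r3 - (z + 2) * r0
  have e1 : 4 * v 0 + 17 * v 1 = -(z ^ 2 + 2 * z) * v 1 := by
    linear_combination r2 - (z + 2) * r1 + 4 * r3
  have v0 : v 0 = 0 := (mul_eq_zero.1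
    (show ((z ^ 2 + 2 * z) ^ 2 + 18 * (z ^ 2 + 2 * z) + 1) * v 0 = 0 by
      linear_combination (17 + z ^ 2 + 2 * z) * e0 - 4 * e1)).resolve_left p1
  have v1 : v 1 = 0 := by rw [v0] at e0; simpa using e0
  have v3 : v 3 = 0 := by rw [v0] at r0; simpa using r0
  have v2 : v 2 = 0 := by rw [v1, v3] at r1; simpa using r1
  have v5 : v 5 = 0 := by rw [r4, v4, mul_zero]
  have v7 : v 7 = 0 := by rw [r6, v6, mul_zero]
  have v8 : v 8 = 0 := by rw [r7, v7, mul_zero]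
  exact hv.2 (funext fun i => by fin_cases i <;> assumption)

/-! ### The bundle -/

/-- The parametrization of the fibre of the bundle by `ℂ × ℝ`. On the span of
`(0, 0, 0, 0, 1, λ, 0, 0, 0)` the automorphism is multiplication by `λ = 2 + √5`, and the complex
coordinate is chosen so that it is multiplication by `λ * rotationUnit` on the plane of vectors
`(a, λa, b, λb, 0, 0, 0, 0, 0)`. -/
def fiberMap : ℂ × ℝ →L[ℝ] Tangent 9 :=
  LinearMap.toContinuousLinearMap
    { toFun := fun x => !₂[x.1.re - rotationTrace / 2 * (x.1.im / rotationSin),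
        dilation * (x.1.re - rotationTrace / 2 * (x.1.im / rotationSin)),
        x.1.im / rotationSin, dilation * (x.1.im / rotationSin), x.2, dilation * x.2, 0, 0, 0]
      map_add' := fun x y => by
        ext i; fin_cases i <;> simp <;> ring
      map_smul' := fun c x => by
        ext i; fin_cases i <;> simp <;> ring }

lemma fiberMap_apply (x : ℂ × ℝ) :
    fiberMap x = !₂[x.1.re - rotationTrace / 2 * (x.1.im / rotationSin),
        dilation * (x.1.re - rotationTrace / 2 * (x.1.im / rotationSin)),
        x.1.im / rotationSin, dilation * (x.1.im / rotationSin), x.2, dilation * x.2, 0, 0, 0] :=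
  rfl

lemma fiberMap_injective : Function.Injective fiberMap := by
  rw [injective_iff_map_eq_zero]
  intro x hx
  have h0 : x.1.re - rotationTrace / 2 * (x.1.im / rotationSin) = 0 := congrArg (· 0) hx
  have h2 : x.1.im / rotationSin = 0 := congrArg (· 2) hx
  have h4 : x.2 = 0 := congrArg (· 4) hx
  rw [h2] at h0
  have him : x.1.im = 0 := (div_eq_zero_iff.1 h2).resolve_right rotationSin_pos.ne'
  exact Prod.ext (Complex.ext (by simpa using h0) him) h4

lemma integerLinearMap_anosovMatrix (v : Tangent 9) (i : Fin 9) :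
    integerLinearMap anosovMatrix v i =
      ![-v 3, -v 2 - 4 * v 3, v 1 - 2 * v 2, v 0 + 4 * v 1 - 2 * v 3, v 5, v 4 + 4 * v 5,
        v 7, v 8, -v 6 - 5 * v 8] i := by
  rw [integerLinearMap_apply, sum_anosovMatrix_mul]

/-- On the fibre the automorphism is the dilation by `λ` composed with a rotation of `ℂ`. -/
lemma integerLinearMap_fiberMap (x : ℂ × ℝ) :
    integerLinearMap anosovMatrix (fiberMap x) =
      fiberMap (dilation • (rotationUnit * x.1, x.2)) := by
  obtain ⟨⟨α, γ⟩, c⟩ := x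
  obtain ⟨β, rfl⟩ : ∃ β, γ = β * rotationSin :=
    ⟨γ / rotationSin, (div_mul_cancel₀ _ rotationSin_pos.ne').symm⟩
  have hs := rotationSin_pos.ne'
  have h1 := dilation_sq
  have h2 := dilation_mul_rotationTrace
  have h3 := rotationSin_sq_add
  have hre : (dilation • (rotationUnit * (⟨α, β * rotationSin⟩ : ℂ), c)).1.re =
      dilation * (rotationTrace / 2 * α - rotationSin ^ 2 * β) := by
    simp [rotationUnit]
    left
    ring
  have him : (dilation • (rotationUnit * (⟨α, β * rotationSin⟩ : ℂ), c)).1.im / rotationSin =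
      dilation * (rotationTrace / 2 * β + α) := by
    simp [rotationUnit]
    field_simp
  have hc : (dilation • (rotationUnit * (⟨α, β * rotationSin⟩ : ℂ), c)).2 = dilation * c := rfl
  ext i
  rw [integerLinearMap_anosovMatrix, fiberMap_apply, fiberMap_apply, hre, him, hc]
  fin_cases i <;> simp [hs]
  · linear_combination (dilation * β) * h3
  · linear_combination (dilation ^ 2 * β) * h3 + β * h1
  · linear_combination (-β) * h2
  · linear_combination (-dilation * β) * h2 + (-α + rotationTrace / 2 * β) * h1 
  · linear_combination -c * h1

/-- The lift to `ℝ⁹` of the perturbed automorphism: a shear depending on the fifth coordinate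
is added in a direction of the plane on which the automorphism is a dilated rotation. -/
def perturbedLift (ε : ℝ) (v : Tangent 9) : Tangent 9 :=
  integerLinearMap anosovMatrix v + (ε * Real.sin (2 * Real.pi * v 4)) • fiberMap (1, 0)

/-- The perturbed automorphism of the torus. -/
def perturbedMap (ε : ℝ) (p : UnitAddTorus (Fin 9)) : UnitAddTorus (Fin 9) :=
  torusLinearMap anosovMatrix p + torusProj ((ε * circleSin (p 4)) • fiberMap (1, 0))

/-- The lift of the inverse of the perturbed automorphism. The fifth coordinate of the preimage
of `w` is `w 5 - 4 * w 4`. -/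
def perturbedLiftInv (ε : ℝ) (w : Tangent 9) : Tangent 9 :=
  integerLinearMap anosovMatrixInv
    (w - (ε * Real.sin (2 * Real.pi * (w 5 - 4 * w 4))) • fiberMap (1, 0))

/-- The inverse of the perturbed automorphism of the torus. -/
def perturbedMapInv (ε : ℝ) (q : UnitAddTorus (Fin 9)) : UnitAddTorus (Fin 9) :=
  torusLinearMap anosovMatrixInv
    (q - torusProj ((ε * circleSin (q 5 - 4 • q 4)) • fiberMap (1, 0)))

lemma perturbedMap_torusProj (ε : ℝ) (v : Tangent 9) :
    perturbedMap ε (torusProj v) = torusProj (perturbedLift ε v) := by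
  rw [perturbedMap, perturbedLift, torusProj_add, torusLinearMap_torusProj]
  simp only [torusProj, circleSin_coe]

lemma perturbedMapInv_torusProj (ε : ℝ) (w : Tangent 9) :
    perturbedMapInv ε (torusProj w) = torusProj (perturbedLiftInv ε w) := by
  have h : circleSin (torusProj w 5 - 4 • torusProj w 4) =
      Real.sin (2 * Real.pi * (w 5 - 4 * w 4)) := by
    rw [← circleSin_coe]
    simp only [torusProj]
    rw [← AddCircle.coe_nsmul, ← AddCircle.coe_sub, nsmul_eq_mul]
    norm_num
  rw [perturbedMapInv, h, ← torusProj_sub, torusLinearMap_torusProj, perturbedLiftInv]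

lemma integerLinearMap_leftInverse {d : ℕ} {M N : Matrix (Fin d) (Fin d) ℤ} (h : M * N = 1)
    (v : Tangent d) : integerLinearMap M (integerLinearMap N v) = v := by
  have h2 : integerLinearMap M * integerLinearMap N = 1 := by
    rw [integerLinearMap, integerLinearMap, ← map_mul, ← Matrix.map_mul_intCast, h]
    simp
  exact congrArg (fun T : Tangent d →L[ℝ] Tangent d => T v) h2

lemma perturbedLift_apply_four (ε : ℝ) (v : Tangent 9) : perturbedLift ε v 4 = v 5 := by
  simp [perturbedLift, fiberMap_apply, integerLinearMap_anosovMatrix]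

lemma perturbedLift_apply_five (ε : ℝ) (v : Tangent 9) :
    perturbedLift ε v 5 = v 4 + 4 * v 5 := by
  simp [perturbedLift, fiberMap_apply, integerLinearMap_anosovMatrix]

lemma perturbedLiftInv_perturbedLift (ε : ℝ) (v : Tangent 9) :
    perturbedLiftInv ε (perturbedLift ε v) = v := by
  rw [perturbedLiftInv, perturbedLift_apply_four, perturbedLift_apply_five,
    show v 4 + 4 * v 5 - 4 * v 5 = v 4 by ring, perturbedLift, add_sub_cancel_right,
    integerLinearMap_leftInverse anosovMatrixInv_mul]

lemma perturbedLift_perturbedLiftInv (ε : ℝ) (w : Tangent 9) :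
    perturbedLift ε (perturbedLiftInv ε w) = w := by
  have h4 : perturbedLiftInv ε w 4 = w 5 - 4 * w 4 := by
    rw [perturbedLiftInv, integerLinearMap_apply]
    simp [anosovMatrixInv, Fin.sum_univ_succ, fiberMap_apply]
    ring
  rw [perturbedLift, h4, perturbedLiftInv, integerLinearMap_leftInverse anosovMatrix_mul_inv,
    sub_add_cancel]

lemma analyticOnNhd_coord {d : ℕ} (i : Fin d) :
    AnalyticOnNhd ℝ (fun v : Tangent d => v i) Set.univ :=
  (EuclideanSpace.proj (𝕜 := ℝ) i).analyticOnNhd _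

lemma analyticTorusFamily_perturbedMap : AnalyticTorusFamily perturbedMap := by
  refine ⟨fun x => perturbedLift x.1 x.2, fun x _ => ?_, perturbedMap_torusProj⟩
  have h4 : AnalyticAt ℝ (fun x : ℝ × Tangent 9 => x.2 4) x :=
    ((EuclideanSpace.proj (𝕜 := ℝ) (4 : Fin 9)).comp
      (ContinuousLinearMap.snd ℝ ℝ (Tangent 9))).analyticAt x
  have hL : AnalyticAt ℝ (fun x : ℝ × Tangent 9 => integerLinearMap anosovMatrix x.2) x :=
    ((integerLinearMap anosovMatrix).comp (ContinuousLinearMap.snd ℝ ℝ (Tangent 9))).analyticAt x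
  exact hL.add (((analyticAt_fst).mul (Real.analyticAt_sin.comp
    (analyticAt_const.mul h4))).smul analyticAt_const)

lemma torusAnalyticDiffeo_perturbedMap (ε : ℝ) : TorusAnalyticDiffeo (perturbedMap ε) := by
  refine ⟨⟨perturbedLift ε, fun x _ => ?_, perturbedMap_torusProj ε⟩, perturbedMapInv ε,
    ⟨perturbedLiftInv ε, fun x _ => ?_, perturbedMapInv_torusProj ε⟩, ?_, ?_⟩
  · exact ((integerLinearMap anosovMatrix).analyticAt x).add
      ((analyticAt_const.mul (Real.analyticAt_sin.comp
        (analyticAt_const.mul (analyticOnNhd_coord 4 x trivial)))).smul analyticAt_const)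
  · exact ((integerLinearMap anosovMatrixInv).analyticAt _).comp
      (analyticAt_id.sub ((analyticAt_const.mul (Real.analyticAt_sin.comp
        (analyticAt_const.mul ((analyticOnNhd_coord 5 x trivial).sub (analyticAt_const.mul
          (analyticOnNhd_coord 4 x trivial)))))).smul analyticAt_const))
  · intro p
    obtain ⟨v, rfl⟩ := torusProj_surjective p
    rw [perturbedMap_torusProj, perturbedMapInv_torusProj, perturbedLiftInv_perturbedLift]
  · intro p
    obtain ⟨v, rfl⟩ := torusProj_surjective p
    rw [perturbedMapInv_torusProj, perturbedMap_torusProj, perturbedLift_perturbedLiftInv]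

lemma isAnosovAutomorphism_perturbedMap_zero : IsAnosovAutomorphism (perturbedMap 0) := by
  refine ⟨anosovMatrix, ?_, fun z hz => anosovMatrix_hyperbolic hz, ?_⟩
  · exact IsUnit.of_mul_eq_one anosovMatrixInv.det
      (by rw [← Matrix.det_mul, anosovMatrix_mul_inv, Matrix.det_one])
  · funext p i
    simp [perturbedMap, torusProj]

/-! ### The derivative cocycle on the bundle -/

/-- The derivative of the shear along the fibre, relative to the dilation. -/
def shearRate (ε : ℝ) (v : Tangent 9) : ℝ :=
  ε * (2 * Real.pi * Real.cos (2 * Real.pi * v 4)) / dilation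

/-- In the coordinates of `fiberMap` the derivative is `λ` times an isometry of the plane
`ℂ × {1}`, a rotation followed by the translation by `shearRate`. -/
lemma exists_hasFDerivAt_perturbedLift (ε : ℝ) (v : Tangent 9) :
    ∃ A : Tangent 9 →L[ℝ] Tangent 9, HasFDerivAt (perturbedLift ε) A v ∧ ∀ w c,
      A (fiberMap (w, c)) =
        fiberMap (dilation • (rotationUnit * w + c * (shearRate ε v : ℂ), c)) := by
  have h4 : HasFDerivAt (fun v : Tangent 9 => v 4)
    (EuclideanSpace.proj (𝕜 := ℝ) (4 : Fin 9) : Tangent 9 →L[ℝ] ℝ) v :=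
    (EuclideanSpace.proj (𝕜 := ℝ) (4 : Fin 9)).hasFDerivAt
  refine ⟨_, (integerLinearMap anosovMatrix).hasFDerivAt.add
    ((((h4.const_mul (2 * Real.pi)).sin).const_mul ε).smul_const (fiberMap (1, 0))),
    fun w c => ?_⟩
  have hc : (fiberMap (w, c)) 4 = c := rfl
  rw [add_apply, integerLinearMap_fiberMap]
  simp only [ContinuousLinearMap.smulRight_apply, smul_apply,
    PiLp.proj_apply, hc, smul_eq_mul]
  rw [← map_smul, ← map_add]
  congr 1
  refine Prod.ext ?_ ?_
  · simp [shearRate]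
    have : (dilation : ℂ) ≠ 0 := by exact_mod_cast dilation_pos.ne'
    field_simp
  · simp

/-- The translation part of the `n`-th iterate of the derivative cocycle at `v`. -/
def translationPart (ε : ℝ) (v : Tangent 9) : ℕ → ℂ
  | 0 => 0
  | n + 1 => rotationUnit * translationPart ε v n + shearRate ε ((perturbedLift ε)^[n] v)

lemma exists_hasFDerivAt_iterate (ε : ℝ) (v : Tangent 9) (n : ℕ) :
    ∃ A : Tangent 9 →L[ℝ] Tangent 9, HasFDerivAt (perturbedLift ε)^[n] A v ∧ ∀ w c,
      A (fiberMap (w, c)) =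
        fiberMap (dilation ^ n • (rotationUnit ^ n * w + c * translationPart ε v n, c)) := by
  induction n with
  | zero => exact ⟨_, hasFDerivAt_id v, fun w c => by simp [translationPart]⟩
  | succ n ih =>
    obtain ⟨A, hA, hA'⟩ := ih
    obtain ⟨B, hB, hB'⟩ := exists_hasFDerivAt_perturbedLift ε ((perturbedLift ε)^[n] v)
    refine ⟨B.comp A, ?_, fun w c => ?_⟩
    · rw [Function.iterate_succ']
      exact hB.comp v hA
    · rw [ContinuousLinearMap.comp_apply, hA', map_smul, map_smul, hB', ← map_smul, smul_smul,
        ← pow_succ]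
      congr 3
      rw [translationPart]
      ring

/-- The derivative of the iterates in the coordinates of `fiberMap`. -/
lemma torusDeriv_iterate_fiberMap (ε : ℝ) (v : Tangent 9) (n : ℕ) (w : ℂ) (c : ℝ) :
    torusDeriv ((perturbedMap ε)^[n]) (torusProj v) (fiberMap (w, c)) =
      fiberMap (dilation ^ n • (rotationUnit ^ n * w + c * translationPart ε v n, c)) := by
  obtain ⟨A, hA, hA'⟩ := exists_hasFDerivAt_iterate ε v n
  rw [torusDeriv_torusProj (iterate_torusProj (perturbedMap_torusProj ε) n) hA, hA']

/-- The affine map `w ↦ ζ * w + τ` of the plane `ℂ × {1}`, extended linearly to `ℂ × ℝ` and dilated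
by `k`. -/
def affineEquiv (k : ℝ) (hk : k ≠ 0) (ζ : ℂ) (hζ : ζ ≠ 0) (τ : ℂ) : (ℂ × ℝ) ≃ₗ[ℝ] (ℂ × ℝ) where
  toFun x := k • (ζ * x.1 + x.2 * τ, x.2)
  map_add' x y := by
    ext <;> simp <;> ring
  map_smul' a x := by
    refine Prod.ext ?_ ?_
    · simp only [Prod.smul_fst, Prod.smul_snd, Complex.real_smul, smul_eq_mul, RingHom.id_apply]
      push_cast
      ring
    · simp only [Prod.smul_snd, smul_eq_mul, RingHom.id_apply]
      ring
  invFun x := (ζ⁻¹ * ((k⁻¹ : ℝ) * (x.1 - x.2 * τ)), k⁻¹ * x.2)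
  left_inv x := by
    have hk' : (k : ℂ) ≠ 0 := by exact_mod_cast hk
    refine Prod.ext ?_ ?_
    · simp; field_simp; ring
    · simp; field_simp
  right_inv x := by
    have hk' : (k : ℂ) ≠ 0 := by exact_mod_cast hk
    refine Prod.ext ?_ ?_
    · simp; field_simp; ring
    · simp; field_simp

/-- The invariant bundle; it is constant in the trivialization by translations. -/
def invariantBundle (_ : UnitAddTorus (Fin 9)) : Submodule ℝ (Tangent 9) :=
  LinearMap.range (fiberMap : ℂ × ℝ →ₗ[ℝ] Tangent 9)

/-- `fiberMap` as an isomorphism onto the fibre. -/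
def fiberEquiv (p : UnitAddTorus (Fin 9)) : (ℂ × ℝ) ≃ₗ[ℝ] invariantBundle p :=
  LinearEquiv.ofInjective (fiberMap : ℂ × ℝ →ₗ[ℝ] Tangent 9) fiberMap_injective

lemma coe_fiberEquiv (p : UnitAddTorus (Fin 9)) (x : ℂ × ℝ) :
    (fiberEquiv p x : Tangent 9) = fiberMap x := rfl

lemma isContinuousSubbundle_invariantBundle : IsContinuousSubbundle 3 invariantBundle := by
  have hdim : Module.finrank ℝ (ℂ × ℝ) = 3 := by simp [Module.finrank_prod]
  let b : Module.Basis (Fin 3) ℝ (ℂ × ℝ) := Module.finBasisOfFinrankEq ℝ (ℂ × ℝ) hdim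
  refine fun p => ⟨Set.univ, isOpen_univ, trivial, fun i _ => fiberMap (b i),
    fun i => continuousOn_const, fun q _ => ⟨?_, ?_⟩⟩
  · exact b.linearIndependent.map' (fiberMap : ℂ × ℝ →ₗ[ℝ] Tangent 9)
      (LinearMap.ker_eq_bot.2 fiberMap_injective)
  · rw [invariantBundle, LinearMap.range_eq_map, ← b.span_eq, Submodule.map_span,
      ← Set.range_comp]
    rfl

/-- The restriction to the fibre of the derivative of the `n`-th iterate. -/
def fiberDeriv (ε : ℝ) (v : Tangent 9) (n : ℕ) (p q : UnitAddTorus (Fin 9)) :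
    invariantBundle p ≃ₗ[ℝ] invariantBundle q :=
  (fiberEquiv p).symm ≪≫ₗ
    affineEquiv (dilation ^ n) (pow_ne_zero n dilation_pos.ne') (rotationUnit ^ n)
      (pow_ne_zero n rotationUnit_ne_zero) (translationPart ε v n) ≪≫ₗ fiberEquiv q

lemma isRestriction_fiberDeriv (ε : ℝ) (v : Tangent 9) (n : ℕ) (q : UnitAddTorus (Fin 9)) :
    IsRestriction (torusDeriv ((perturbedMap ε)^[n]) (torusProj v))
      (fiberDeriv ε v n (torusProj v) q) := by
  intro u
  obtain ⟨x, rfl⟩ := (fiberEquiv (torusProj v)).surjective u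
  rw [coe_fiberEquiv, torusDeriv_iterate_fiberMap]
  simp only [fiberDeriv, LinearEquiv.trans_apply, LinearEquiv.symm_apply_apply, coe_fiberEquiv]
  rfl

lemma preservesBundle_perturbedMap (ε : ℝ) :
    PreservesBundle (perturbedMap ε) invariantBundle := by
  intro p
  obtain ⟨v, rfl⟩ := torusProj_surjective p
  have h := isRestriction_fiberDeriv ε v 1 (perturbedMap ε (torusProj v))
  rw [Function.iterate_one] at h
  ext y
  constructor
  · rintro ⟨u, hu, rfl⟩
    have := h ⟨u, hu⟩
    exact this ▸ Subtype.property _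
  · intro hy
    obtain ⟨u, hu⟩ := (fiberDeriv ε v 1 (torusProj v) (perturbedMap ε (torusProj v))).surjective
      ⟨y, hy⟩
    exact ⟨u, u.2, by rw [ContinuousLinearMap.coe_coe, ← h u, hu]⟩

/-! ### Conformality at periodic points -/

lemma opNorm_eq_of_scaling {V W : Type*} [AddCommGroup V] [Module ℝ V] [AddCommGroup W]
    [Module ℝ W] {N : Seminorm ℝ V} {N' : Seminorm ℝ W} {A : V →ₗ[ℝ] W} {k : ℝ} (hk : 0 ≤ k)
    (hA : ∀ v, N' (A v) = k * N v) {v : V} (hv : N v ≠ 0) : opNorm N N' A = k := by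
  have hpos : 0 < N v := lt_of_le_of_ne (apply_nonneg N v) hv.symm
  have : IsLeast {c : ℝ | 0 ≤ c ∧ ∀ v, N' (A v) ≤ c * N v} k :=
    ⟨⟨hk, fun v => (hA v).le⟩, fun c hc => le_of_mul_le_mul_right ((hA v).symm.trans_le (hc.2 v))
      hpos⟩
  exact this.csInf_eq

/-- A linear automorphism that multiplies a norm by a constant is conformal in that norm. -/
lemma conformalInSomeNorm_of_scaling {V : Type*} [AddCommGroup V] [Module ℝ V] [Nontrivial V]
    {N : Seminorm ℝ V} (hN : IsNorm N) {A : V ≃ₗ[ℝ] V} {k : ℝ} (hk : 0 < k)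
    (hA : ∀ v, N (A v) = k * N v) : ConformalInSomeNorm A := by
  obtain ⟨v, hv⟩ := exists_ne (0 : V)
  have hv' : N v ≠ 0 := fun h => hv (hN v h)
  refine ⟨N, hN, ?_⟩
  rw [qcDistortion, opNorm_eq_of_scaling hk.le (A := (A : V →ₗ[ℝ] V)) hA hv',
    opNorm_eq_of_scaling (inv_nonneg.2 hk.le) (A := (A.symm : V →ₗ[ℝ] V)) (fun u => ?_) hv',
    mul_inv_cancel₀ hk.ne']
  have := hA (A.symm u)
  rw [A.apply_symm_apply] at this
  rw [this, inv_mul_cancel_left₀ hk.ne']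
  rfl

/-- A dilated plane isometry with nontrivial rotation fixes a point `w₀` of the plane `ℂ × {1}`,
so it scales the norm `max |w - c w₀| |c|` centred at this point. -/
lemma conformalInSomeNorm_affineEquiv {V : Type*} [AddCommGroup V] [Module ℝ V]
    (e : (ℂ × ℝ) ≃ₗ[ℝ] V) {k : ℝ} (hk : 0 < k) {ζ : ℂ} (hζ : ‖ζ‖ = 1) (hζ0 : ζ ≠ 0)
    (hζ1 : ζ ≠ 1) (τ : ℂ) :
    ConformalInSomeNorm (e.symm ≪≫ₗ affineEquiv k hk.ne' ζ hζ0 τ ≪≫ₗ e) := by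
  have hne : 1 - ζ ≠ 0 := sub_ne_zero.2 hζ1.symm
  set w₀ : ℂ := τ / (1 - ζ) with hw₀
  have hfix : ζ * w₀ + τ = w₀ := by rw [hw₀]; field_simp; ring
  let T : (ℂ × ℝ) →ₗ[ℝ] (ℂ × ℝ) :=
    { toFun := fun x => (x.1 - x.2 * w₀, x.2)
      map_add' := fun x y => by
        refine Prod.ext ?_ rfl
        simp
        ring
      map_smul' := fun a x => by
        refine Prod.ext ?_ rfl
        simp only [Prod.smul_fst, Prod.smul_snd, Complex.real_smul, smul_eq_mul, RingHom.id_apply]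
        push_cast
        ring }
  have hT : ∀ x, T x = (x.1 - x.2 * w₀, x.2) := fun _ => rfl
  let N : Seminorm ℝ V := (normSeminorm ℝ (ℂ × ℝ)).comp (T ∘ₗ (e.symm : V →ₗ[ℝ] ℂ × ℝ))
  have hN : ∀ x, N (e x) = ‖T x‖ := fun x => by
    simp [N]
  have : Nontrivial V := e.symm.toEquiv.nontrivial
  refine conformalInSomeNorm_of_scaling (N := N) (fun u hu => ?_) hk fun u => ?_
  · obtain ⟨x, rfl⟩ := e.surjective u
    rw [hN, norm_eq_zero, hT, Prod.mk_eq_zero] at hu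
    obtain ⟨h1, h2⟩ := hu
    rw [h2] at h1
    have : x = 0 := Prod.ext (by simpa using h1) h2
    rw [this, map_zero]
  · obtain ⟨x, rfl⟩ := e.surjective u
    simp only [LinearEquiv.trans_apply, LinearEquiv.symm_apply_apply]
    rw [hN, hN]
    have hx : T (affineEquiv k hk.ne' ζ hζ0 τ x) = k • (ζ * (x.1 - x.2 * w₀), x.2) := by
      change T (k • (ζ * x.1 + x.2 * τ, x.2)) = _
      rw [map_smul, hT]
      congr 2
      linear_combination (x.2 : ℂ) * hfix
    rw [hx, norm_smul, Real.norm_of_nonneg hk.le, hT, Prod.norm_mk, Prod.norm_mk, norm_mul, hζ,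
      one_mul]

lemma conformalInSomeNorm_fiberDeriv (ε : ℝ) (v : Tangent 9) {n : ℕ} (hn : 0 < n)
    (p : UnitAddTorus (Fin 9)) : ConformalInSomeNorm (fiberDeriv ε v n p p) :=
  conformalInSomeNorm_affineEquiv _ (pow_pos dilation_pos n)
    (by rw [norm_pow, norm_rotationUnit, one_pow]) _ (rotationUnit_pow_ne_one hn) _

/-! ### Failure of uniform quasi-conformality -/

/-- The operator norm of a bounded linear map is a bound. -/
lemma le_opNorm_mul {V W : Type*} [AddCommGroup V] [Module ℝ V] [AddCommGroup W] [Module ℝ W]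
    {N : Seminorm ℝ V} {N' : Seminorm ℝ W} {A : V →ₗ[ℝ] W}
    (h : ∃ c : ℝ, 0 ≤ c ∧ ∀ v, N' (A v) ≤ c * N v) (v : V) : N' (A v) ≤ opNorm N N' A * N v := by
  rcases (apply_nonneg N v).eq_or_lt with h0 | hpos
  · obtain ⟨c, _, hc⟩ := h
    simpa [← h0] using hc v
  · rw [← div_le_iff₀ hpos]
    exact le_csInf h fun c hc => (div_le_iff₀ hpos).2 (hc.2 v)

lemma opNorm_nonneg {V W : Type*} [AddCommGroup V] [Module ℝ V] [AddCommGroup W] [Module ℝ W]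
    (N : Seminorm ℝ V) (N' : Seminorm ℝ W) (A : V →ₗ[ℝ] W) : 0 ≤ opNorm N N' A :=
  Real.sInf_nonneg fun _ hc => hc.1

/-- The distortion bounds the ratio of the expansions of any two vectors. -/
lemma norm_mul_norm_le_qcDistortion {V W : Type*} [NormedAddCommGroup V] [NormedSpace ℝ V]
    [NormedAddCommGroup W] [NormedSpace ℝ W] [FiniteDimensional ℝ V] [FiniteDimensional ℝ W]
    (A : V ≃ₗ[ℝ] W) (x y : V) :
    ‖A x‖ * ‖y‖ ≤ qcDistortion (normSeminorm ℝ V) (normSeminorm ℝ W) A * (‖x‖ * ‖A y‖) := by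
  have h1 := le_opNorm_mul (N := normSeminorm ℝ V) (N' := normSeminorm ℝ W)
    (A := (A : V →ₗ[ℝ] W)) ⟨_, norm_nonneg (LinearMap.toContinuousLinearMap (A : V →ₗ[ℝ] W)),
      (LinearMap.toContinuousLinearMap (A : V →ₗ[ℝ] W)).le_opNorm⟩ x
  have h2 := le_opNorm_mul (N := normSeminorm ℝ W) (N' := normSeminorm ℝ V)
    (A := (A.symm : W →ₗ[ℝ] V))
    ⟨_, norm_nonneg (LinearMap.toContinuousLinearMap (A.symm : W →ₗ[ℝ] V)),
      (LinearMap.toContinuousLinearMap (A.symm : W →ₗ[ℝ] V)).le_opNorm⟩ (A y)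
  simp only [coe_normSeminorm, LinearEquiv.coe_coe, LinearEquiv.symm_apply_apply] at h1 h2
  refine (mul_le_mul h1 h2 (norm_nonneg _)
    (mul_nonneg (opNorm_nonneg _ _ _) (norm_nonneg _))).trans_eq ?_
  rw [qcDistortion]
  ring

/-- A bound on the distortions bounds the translation parts. -/
lemma exists_norm_translationPart_le {ε : ℝ}
    (h : UniformlyQuasiConformal (perturbedMap ε) invariantBundle) :
    ∃ C, ∀ v n, ‖translationPart ε v n‖ ≤ C := by
  obtain ⟨C, hC⟩ := h
  obtain ⟨K, hK0, hK⟩ := (fiberMap : ℂ × ℝ →ₗ[ℝ] Tangent 9).exists_antilipschitzWith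
    (LinearMap.ker_eq_bot.2 fiberMap_injective)
  have hK' : ∀ x, ‖x‖ ≤ K * ‖fiberMap x‖ := fun x => by
    simpa using hK.le_mul_dist x 0
  refine ⟨K * (C * (‖fiberMap (0, 1)‖ * ‖fiberMap‖)) / ‖fiberMap (1, 0)‖, fun v n => ?_⟩
  have hne : 0 < ‖fiberMap (1, 0)‖ := by
    rw [norm_pos_iff]
    exact fun h0 => by
      simpa using congrArg Prod.fst (fiberMap_injective (h0.trans fiberMap.map_zero.symm))
  have hL : 0 < dilation ^ n := pow_pos dilation_pos n
  set p := torusProj v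
  set q := (perturbedMap ε)^[n] p
  have hr := isRestriction_fiberDeriv ε v n q
  have hA := hC p n (fiberDeriv ε v n p q) hr
  -- compare the expansion of the transversal vector with that of a vector of the plane
  have hle := (norm_mul_norm_le_qcDistortion (fiberDeriv ε v n p q) (fiberEquiv p (0, 1))
    (fiberEquiv p (1, 0))).trans (mul_le_mul_of_nonneg_right hA (by positivity))
  have hx : ‖fiberDeriv ε v n p q (fiberEquiv p (0, 1))‖ =
      dilation ^ n * ‖fiberMap (translationPart ε v n, 1)‖ := by
    rw [Submodule.coe_norm, hr, coe_fiberEquiv, torusDeriv_iterate_fiberMap, map_smul, norm_smul,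
      Real.norm_of_nonneg hL.le]
    simp
  have hy : ‖fiberDeriv ε v n p q (fiberEquiv p (1, 0))‖ =
      dilation ^ n * ‖fiberMap (rotationUnit ^ n, 0)‖ := by
    rw [Submodule.coe_norm, hr, coe_fiberEquiv, torusDeriv_iterate_fiberMap, map_smul, norm_smul,
      Real.norm_of_nonneg hL.le]
    simp
  rw [hx, hy, Submodule.coe_norm, Submodule.coe_norm, coe_fiberEquiv, coe_fiberEquiv] at hle
  have hle2 : ‖fiberMap (translationPart ε v n, 1)‖ * ‖fiberMap (1, 0)‖ ≤
      C * (‖fiberMap (0, 1)‖ * ‖fiberMap (rotationUnit ^ n, 0)‖) := by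
    refine le_of_mul_le_mul_left ?_ hL
    linarith
  have hC0 : 0 ≤ C :=
    (mul_nonneg (opNorm_nonneg _ _ _) (opNorm_nonneg _ _ _)).trans hA
  have hrot : ‖fiberMap (rotationUnit ^ n, 0)‖ ≤ ‖fiberMap‖ := by
    refine (fiberMap.le_opNorm _).trans_eq ?_
    rw [Prod.norm_mk, norm_pow, norm_rotationUnit]
    simp
  have htau : ‖translationPart ε v n‖ ≤ K * ‖fiberMap (translationPart ε v n, 1)‖ :=
    (norm_fst_le (translationPart ε v n, (1 : ℝ))).trans (hK' _)
  rw [le_div_iff₀ hne]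
  calc ‖translationPart ε v n‖ * ‖fiberMap (1, 0)‖
      ≤ K * ‖fiberMap (translationPart ε v n, 1)‖ * ‖fiberMap (1, 0)‖ := by gcongr
    _ ≤ K * (C * (‖fiberMap (0, 1)‖ * ‖fiberMap (rotationUnit ^ n, 0)‖)) := by
        rw [mul_assoc]; gcongr
    _ ≤ _ := by gcongr

/-- The solution `0, 1, 4, 17, …` of `β (n + 2) = 4 β (n + 1) + β n`: the frequencies with which
the orbit of a point on the sixth coordinate axis meets the shear. -/
def orbitFrequency : ℕ → ℕ
  | 0 => 0
  | 1 => 1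
  | n + 2 => 4 * orbitFrequency (n + 1) + orbitFrequency n

lemma orbitFrequency_strictMono : StrictMono orbitFrequency := by
  have h : ∀ n, orbitFrequency n < orbitFrequency (n + 1) := by
    intro n
    induction n with
    | zero => simp [orbitFrequency]
    | succ n ih => rw [orbitFrequency]; omega
  exact strictMono_nat_of_lt_succ h

lemma iterate_perturbedLift_axis (ε θ : ℝ) (n : ℕ) :
    (perturbedLift ε)^[n] (EuclideanSpace.single 5 θ) 4 = orbitFrequency n * θ ∧
    (perturbedLift ε)^[n] (EuclideanSpace.single 5 θ) 5 = orbitFrequency (n + 1) * θ := by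
  induction n with
  | zero => simp [orbitFrequency]
  | succ n ih =>
    rw [Function.iterate_succ_apply', perturbedLift_apply_four, perturbedLift_apply_five, ih.1,
      ih.2, orbitFrequency]
    refine ⟨rfl, ?_⟩
    push_cast
    ring

/-- On the sixth axis the translation part is, up to a unimodular factor and a constant, a cosine
sum with unimodular coefficients. -/
lemma translationPart_axis (ε θ : ℝ) (n : ℕ) :
    translationPart ε (EuclideanSpace.single 5 θ) n =
      (ε * (2 * Real.pi) / dilation : ℝ) * rotationUnit ^ n *
        ∑ j ∈ Finset.range n, (rotationUnit⁻¹) ^ (j + 1) *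
          (Real.cos (2 * Real.pi * (orbitFrequency j * θ)) : ℂ) := by
  induction n with
  | zero => simp [translationPart]
  | succ n ih =>
    have h : rotationUnit ^ (n + 1) * rotationUnit⁻¹ ^ (n + 1) = 1 := by
      rw [← mul_pow, mul_inv_cancel₀ rotationUnit_ne_zero, one_pow]
    rw [translationPart, ih, Finset.sum_range_succ, shearRate, (iterate_perturbedLift_axis ε θ n).1]
    push_cast
    linear_combination (-(ε * (2 * Real.pi) / dilation *
      Complex.cos (2 * Real.pi * (orbitFrequency n * θ))) : ℂ) * h

lemma not_uniformlyQuasiConformal_perturbedMap {ε : ℝ} (hε : ε ≠ 0) :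
    ¬ UniformlyQuasiConformal (perturbedMap ε) invariantBundle := by
  intro h
  obtain ⟨C, hC⟩ := exists_norm_translationPart_le h
  set κ : ℝ := ε * (2 * Real.pi) / dilation with hκ
  have hκ0 : 0 < |κ| := by
    have := dilation_pos
    have : κ ≠ 0 := by rw [hκ]; positivity
    positivity
  obtain ⟨n, θ, hn⟩ := not_bounded_sum_unimodular_mul_cos orbitFrequency_strictMono.injective
    (ζ := fun j => (rotationUnit⁻¹) ^ (j + 1))
    (fun j => by rw [norm_pow, norm_inv, norm_rotationUnit, inv_one, one_pow]) (C / |κ|)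
  have hb := hC (EuclideanSpace.single 5 θ) n
  rw [translationPart_axis, norm_mul, norm_mul, norm_pow, norm_rotationUnit, one_pow, mul_one,
    Complex.norm_real, Real.norm_eq_abs, ← hκ] at hb
  rw [div_lt_iff₀ hκ0] at hn
  linarith

end

theorem mainTheorem5 :
    ∃ (f : ℝ → UnitAddTorus (Fin 9) → UnitAddTorus (Fin 9))
      (E : UnitAddTorus (Fin 9) → Submodule ℝ (Tangent 9)),
      AnalyticTorusFamily f ∧
      (∀ ε : ℝ, TorusAnalyticDiffeo (f ε)) ∧
      IsAnosovAutomorphism (f 0) ∧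
      IsContinuousSubbundle 3 E ∧
      (∀ ε : ℝ, PreservesBundle (f ε) E) ∧
      (∀ (ε : ℝ) (p : UnitAddTorus (Fin 9)) (n : ℕ), 0 < n → (f ε)^[n] p = p →
        ∃ A : E p ≃ₗ[ℝ] E p,
          IsRestriction (torusDeriv ((f ε)^[n]) p) A ∧ ConformalInSomeNorm A) ∧
      (∀ ε : ℝ, ε ≠ 0 → ¬ UniformlyQuasiConformal (f ε) E) := by
  refine ⟨perturbedMap, invariantBundle, analyticTorusFamily_perturbedMap,
    torusAnalyticDiffeo_perturbedMap, isAnosovAutomorphism_perturbedMap_zero,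
    isContinuousSubbundle_invariantBundle, preservesBundle_perturbedMap, fun ε p n hn _ => ?_,
    fun ε hε => not_uniformlyQuasiConformal_perturbedMap hε⟩
  obtain ⟨v, rfl⟩ := torusProj_surjective p
  exact ⟨fiberDeriv ε v n _ _, isRestriction_fiberDeriv ε v n _,
    conformalInSomeNorm_fiberDeriv ε v hn _⟩
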